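/- Let $n\ge 1$ and $N=\{1,\dots,n\}$. A simple game on $N$ is a family $W$ of subsets of $N$ (the winning coalitions; the others are losing) with $N\in W$, $\emptyset\notin W$, and closed under passing to larger subsets of $N$. It is weighted if there are weights $w_i\ge 0$ and a quota $q\in(0,\sum_i w_i]$ such that $A\in W\iff w_A:=\sum_{i\in A}w_i\ge q$; otherwise it is unweighted. Let $J_n$ be the set of linear games on $N$ with voters labelled by increasing desirability, i.e. of simple games such that for all $i\le j$ and $S\subseteq N\setminus\{i,j\}$, $S\cup\{i\}\in W$ implies $S\cup\{j\}\in W$. Order $J_n$ by $v\succeq u\iff W_v\subseteq W_u$; "covers" refers to this partial order. For $A,B\subseteq N$ with elements listed in decreasing order, $A=\{a_1>\dots>a_k\}$, $B=\{b_1>\dots>b_j\}$, put $A\le B$ if $k\le j$ and $a_i\le b_i$ for $1\le i\le k$. The shift-minimal winning coalitions of $v\in J_n$ are the elements of $W_v$ that are minimal for this order. Let $\Delta_n=\{w\in\mathbf R^n: w_n\ge\dots\ge w_1\ge 0,\ \sum_i w_i=1\}$, and for a weighted game $v\in J_n$ let $P_v\subseteq(0,1]\times\Delta_n$ be the set of points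 $(q,w)$ that realize $v$, i.e. such that $A\in W_v\iff q\le w_A$ for all $A\subseteq N$. A facet of $P_v$ is a nonempty face of the closure of $P_v$, cut out by a supporting hyperplane, of dimension $\dim P_v-1$. It is a top facet if it is contained in a hyperplane $\{q=w_A\}$ with $A$ a winning coalition of $v$, and a bottom facet if it is contained in a hyperplane $\{q=w_A\}$ with $A$ a losing coalition of $v$. **Corollary.** Let $v\in J_n$ be a weighted game and let $k,\ell\ge 0$ be integers. 1. If $v$ has $k$ more shift-minimal winning coalitions than $P_v$ has top facets, then exactly $k$ of the games covering $v$ in $J_n$ are unweighted. 2. If $v$ covers $\ell$ more games in $J_n$ than $P_v$ has bottom facets, then exactly $\ell$ of the games covered by $v$ in $J_n$ are unweighted. -/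

import Mathlib

/-- A simple game on the voters `Fin n` (`i : Fin n` is the voter number `i + 1`): a monotone
family of winning coalitions in which the grand coalition wins and the empty one loses. -/
@[ext]
structure SimpleGame (n : ℕ) where
  winning : Set (Finset (Fin n))
  univ_winning : Finset.univ ∈ winning
  empty_losing : ∅ ∉ winning
  mono : ∀ S R : Finset (Fin n), S ∈ winning → S ⊆ R → R ∈ winning

/-- Voter `i` is (weakly) more desirable than voter `j`. -/
def SimpleGame.MoreDesirable {n : ℕ} (v : SimpleGame n) (i j : Fin n) : Prop :=
  ∀ S : Finset (Fin n), i ∉ S → j ∉ S → insert j S ∈ v.winning → insert i S ∈ v.winning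

/-- `v` is weighted: there are nonnegative weights `w` (in no prescribed order) and a quota
`0 < q ≤ ∑ w i` such that a coalition wins iff its weight is at least the quota. -/
def SimpleGame.IsWeighted {n : ℕ} (v : SimpleGame n) : Prop :=
  ∃ (q : ℝ) (w : Fin n → ℝ), (∀ i, 0 ≤ w i) ∧ 0 < q ∧ q ≤ ∑ i, w i ∧
    ∀ A : Finset (Fin n), A ∈ v.winning ↔ q ≤ ∑ i ∈ A, w i

/-- The elements of `J_n`: linear games, i.e. simple games with total desirability relation, with
the voters labelled by increasing desirability. -/
structure LinearGame (n : ℕ) extends SimpleGame n where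
  desirable : ∀ i j : Fin n, i ≤ j → toSimpleGame.MoreDesirable j i

/-- The order of the poset `J_n`: `u ≤ v` (`v` is stronger than `u`) iff every coalition that
wins in `v` wins in `u`. -/
instance LinearGame.instPartialOrder (n : ℕ) : PartialOrder (LinearGame n) where
  le u v := v.winning ⊆ u.winning
  le_refl _ := Set.Subset.rfl
  le_trans _ _ _ h₁ h₂ := Set.Subset.trans h₂ h₁
  le_antisymm u v h₁ h₂ := by
    obtain ⟨u, hu⟩ := u
    obtain ⟨v, hv⟩ := v
    have h : u = v := SimpleGame.ext (Set.Subset.antisymm h₂ h₁)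
    subst h
    rfl

/-- The order `A ≤ B` of the coalitions poset `M(n)`: `A` has at most as many members as `B`, and
the `i`-th largest member of `A` is at most the `i`-th largest member of `B`, for all
`i ≤ |A|`. (`orderEmbOfFin` lists in increasing order, hence the `rev`.) -/
def CoalitionLE {n : ℕ} (A B : Finset (Fin n)) : Prop :=
  ∃ h : A.card ≤ B.card, ∀ i : Fin A.card,
    A.orderEmbOfFin rfl i.rev ≤ B.orderEmbOfFin rfl (Fin.castLE h i).rev

/-- The shift-minimal winning coalitions: the minimal elements, in `M(n)`, of the set of winning
coalitions. -/
def LinearGame.shiftMinimalWinning {n : ℕ} (v : LinearGame n) : Set (Finset (Fin n)) :=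
  {A | A ∈ v.winning ∧ ∀ B ∈ v.winning, CoalitionLE B A → B = A}

/-- The simplex `Δ_n` of normalized weights `0 ≤ w_1 ≤ ... ≤ w_n` with sum `1`. -/
def normalizedWeights (n : ℕ) : Set (Fin n → ℝ) :=
  {w | Monotone w ∧ (∀ i, 0 ≤ w i) ∧ ∑ i, w i = 1}

/-- The configuration region `C_n = (0, 1] × Δ_n`; a point is a pair (quota, weights). -/
def configRegion (n : ℕ) : Set (ℝ × (Fin n → ℝ)) :=
  Set.Ioc (0 : ℝ) 1 ×ˢ normalizedWeights n

/-- The polytope `P_v`: all points of the configuration region that realize `v`. -/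
def LinearGame.polytope {n : ℕ} (v : LinearGame n) : Set (ℝ × (Fin n → ℝ)) :=
  {p | p ∈ configRegion n ∧ ∀ A : Finset (Fin n), A ∈ v.winning ↔ p.1 ≤ ∑ i ∈ A, p.2 i}

/-- The hyperplane `h_A`, on which the quota equals the weight of `A`. -/
def coalitionHyperplane {n : ℕ} (A : Finset (Fin n)) : Set (ℝ × (Fin n → ℝ)) :=
  {p | p.1 = ∑ i ∈ A, p.2 i}

/-- `F` is a facet of the (not necessarily closed) polytope `P`: a nonempty face of the closure
of `P`, cut out by a supporting hyperplane, of dimension one less than `P`. -/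
def IsFacet {E : Type*} [AddCommGroup E] [Module ℝ E] [TopologicalSpace E] (P F : Set E) : Prop :=
  F.Nonempty ∧ IsExposed ℝ (closure P) F ∧
    Module.finrank ℝ (vectorSpan ℝ F) + 1 = Module.finrank ℝ (vectorSpan ℝ P)

/-- The top facets of `P_v`: the facets lying in `h_A` for some winning coalition `A`. -/
def LinearGame.topFacets {n : ℕ} (v : LinearGame n) : Set (Set (ℝ × (Fin n → ℝ))) :=
  {F | IsFacet v.polytope F ∧ ∃ A : Finset (Fin n), A ∈ v.winning ∧ F ⊆ coalitionHyperplane A}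

/-- The bottom facets of `P_v`: the facets lying in `h_A` for some losing coalition `A`. -/
def LinearGame.bottomFacets {n : ℕ} (v : LinearGame n) : Set (Set (ℝ × (Fin n → ℝ))) :=
  {F | IsFacet v.polytope F ∧ ∃ A : Finset (Fin n), A ∉ v.winning ∧ F ⊆ coalitionHyperplane A}

/-! Call `A` a wall coalition of `v` if some normalized point of the hyperplane `h_A` realizes `v`
with strict inequalities at every coalition other than `A`. Both counts in the theorem reduce to
counting walls.

Combinatorially, going up a cover in `J_n` deletes exactly one shift-minimal winning coalition, and
every such coalition except the grand one can be deleted (`LinearGame.encard_covering`).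
Geometrically, `A ↦ closure P_v ∩ h_A` is a bijection from wall coalitions to the facets lying in
some coalition hyperplane (`LinearGame.encard_facets`), with winning `A` giving top facets and
losing `A` bottom facets.

The link is convexity. Pushing the quota just across a wall yields a weighted neighbour differing
from `v` only at `A`. Conversely, the segment between strict realizations of two weighted games
differing only at `A` meets `h_A` in a wall point (`LinearGame.hasWall_of_isWeighted`). So facets
count weighted neighbours, and the excess counts unweighted ones.

Two walls lead to no neighbour: `h_N`, when only `N` wins, and `h_∅`, when every nonempty coalition
wins. They are treated separately. -/

open Filter Topology

/-! ### The coalitions poset through tail counts -/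

/-- The number of members of `A` that are at least `t`. -/
def tailCard {n : ℕ} (A : Finset (Fin n)) (t : ℕ) : ℕ :=
  (A.filter fun i : Fin n => t ≤ (i : ℕ)).card

theorem tailCard_zero {n : ℕ} (A : Finset (Fin n)) : tailCard A 0 = A.card := by
  simp [tailCard]

theorem tailCard_mono {n : ℕ} {A B : Finset (Fin n)} (h : A ⊆ B) (t : ℕ) :
    tailCard A t ≤ tailCard B t :=
  Finset.card_le_card (Finset.filter_subset_filter _ h)

theorem tailCard_insert {n : ℕ} {A : Finset (Fin n)} {i : Fin n} (hi : i ∉ A) (t : ℕ) :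
    tailCard (insert i A) t = tailCard A t + if t ≤ (i : ℕ) then 1 else 0 := by
  unfold tailCard
  rw [Finset.filter_insert]
  split_ifs
  · rw [Finset.card_insert_of_notMem (by simp [hi])]
  · rfl

theorem tailCard_succ {n : ℕ} (A : Finset (Fin n)) (i : Fin n) :
    tailCard A i = tailCard A (i + 1) + if i ∈ A then 1 else 0 := by
  unfold tailCard
  split_ifs with hi
  · rw [← Finset.card_insert_of_notMem (a := i) (by simp)]
    congr 1
    ext j
    simp only [Finset.mem_filter, Finset.mem_insert, Fin.ext_iff]
    constructor
    · rintro ⟨h₁, h₂⟩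
      rcases h₂.eq_or_lt with h | h
      · exact Or.inl h.symm
      · exact Or.inr ⟨h₁, h⟩
    · rintro (h | ⟨h₁, h₂⟩)
      · exact ⟨(Fin.ext h : j = i) ▸ hi, h.ge⟩
      · exact ⟨h₁, by omega⟩
  · congr 1
    ext j
    simp only [Finset.mem_filter]
    refine and_congr_right fun hj => ?_
    have : j ≠ i := fun h => hi (h ▸ hj)
    have := Fin.val_ne_of_ne this
    omega

theorem eq_of_tailCard_eq {n : ℕ} {A B : Finset (Fin n)} (h : ∀ t, tailCard A t = tailCard B t) :
    A = B := by
  ext i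
  have h₁ := tailCard_succ A i
  have h₂ := tailCard_succ B i
  rw [h, h] at h₁
  by_cases hA : i ∈ A <;> by_cases hB : i ∈ B <;> simp [hA, hB] at * <;> omega

/-- Matching `i`-th largest members sends each tail of `A` injectively into the same tail of `B`.
Conversely, if the `i`-th largest member `t` of `A` exceeded that of `B`, then `B` would have fewer
members from `t` on than `A`. -/
theorem coalitionLE_iff_tailCard {n : ℕ} {A B : Finset (Fin n)} :
    CoalitionLE A B ↔ ∀ t, tailCard A t ≤ tailCard B t := by
  constructor
  · rintro ⟨h, hAB⟩ t
    set f : Fin A.card → Fin n := fun i => A.orderEmbOfFin rfl i.rev with hf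
    set g : Fin A.card → Fin n := fun i => B.orderEmbOfFin rfl (Fin.castLE h i).rev with hg
    have hginj : Function.Injective g := by
      intro i j hij
      simpa [hg] using hij
    let K : Finset (Fin A.card) := Finset.univ.filter fun i => t ≤ (g i : ℕ)
    have h₁ : A.filter (fun i : Fin n => t ≤ (i : ℕ)) ⊆ K.image f := by
      intro x hx
      obtain ⟨hxA, hxt⟩ := Finset.mem_filter.1 hx
      have : x ∈ Set.range (A.orderEmbOfFin rfl) := by simpa using hxA
      obtain ⟨i, rfl⟩ := this
      refine Finset.mem_image.2 ⟨i.rev, ?_, by simp [hf]⟩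
      refine Finset.mem_filter.2 ⟨Finset.mem_univ _, ?_⟩
      have := hAB i.rev
      rw [Fin.rev_rev] at this
      exact hxt.trans this
    have h₂ : K.image g ⊆ B.filter (fun i : Fin n => t ≤ (i : ℕ)) := by
      intro x hx
      obtain ⟨i, hi, rfl⟩ := Finset.mem_image.1 hx
      exact Finset.mem_filter.2 ⟨Finset.orderEmbOfFin_mem _ _ _, (Finset.mem_filter.1 hi).2⟩
    calc tailCard A t ≤ (K.image f).card := Finset.card_le_card h₁
      _ ≤ K.card := Finset.card_image_le
      _ = (K.image g).card := (Finset.card_image_of_injective _ hginj).symm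
      _ ≤ tailCard B t := Finset.card_le_card h₂
  · intro h
    have hc : A.card ≤ B.card := by simpa [tailCard_zero] using h 0
    refine ⟨hc, fun i => ?_⟩
    by_contra! hlt
    set t : Fin n := A.orderEmbOfFin rfl i.rev
    have h₁ : (Finset.Iic i).image (fun k => A.orderEmbOfFin rfl k.rev) ⊆
        A.filter (fun x : Fin n => (t : ℕ) ≤ (x : ℕ)) := by
      intro x hx
      obtain ⟨k, hk, rfl⟩ := Finset.mem_image.1 hx
      refine Finset.mem_filter.2 ⟨Finset.orderEmbOfFin_mem _ _ _, ?_⟩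
      exact (A.orderEmbOfFin rfl).monotone (Fin.rev_le_rev.2 (Finset.mem_Iic.1 hk))
    have h₂ : B.filter (fun x : Fin n => (t : ℕ) ≤ (x : ℕ)) ⊆
        (Finset.Iio (Fin.castLE hc i)).image (fun k => B.orderEmbOfFin rfl k.rev) := by
      intro x hx
      obtain ⟨hxB, hxt⟩ := Finset.mem_filter.1 hx
      have : x ∈ Set.range (B.orderEmbOfFin rfl) := by simpa using hxB
      obtain ⟨k, rfl⟩ := this
      refine Finset.mem_image.2 ⟨k.rev, Finset.mem_Iio.2 ?_, by simp⟩
      have := hlt.trans_le (show t ≤ _ from hxt)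
      rw [(B.orderEmbOfFin rfl).lt_iff_lt] at this
      rwa [← Fin.rev_lt_rev, Fin.rev_rev]
    have h₃ := Finset.card_le_card h₁
    have h₄ := (Finset.card_le_card h₂).trans Finset.card_image_le
    rw [Finset.card_image_of_injective _ (by intro a b hab; simpa using hab)] at h₃
    have h₅ := h t
    unfold tailCard at h₅
    simp only [Fin.card_Iic, Fin.card_Iio, Fin.val_castLE] at h₃ h₄
    omega

theorem CoalitionLE.antisymm {n : ℕ} {A B : Finset (Fin n)} (h₁ : CoalitionLE A B)
    (h₂ : CoalitionLE B A) : A = B := by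
  rw [coalitionLE_iff_tailCard] at h₁ h₂
  exact eq_of_tailCard_eq fun t => (h₁ t).antisymm (h₂ t)

theorem coalitionLE_of_subset {n : ℕ} {A B : Finset (Fin n)} (h : A ⊆ B) : CoalitionLE A B :=
  coalitionLE_iff_tailCard.2 fun t => tailCard_mono h t

theorem coalitionLE_insert {n : ℕ} {S : Finset (Fin n)} {i j : Fin n} (hij : i ≤ j)
    (hi : i ∉ S) (hj : j ∉ S) : CoalitionLE (insert i S) (insert j S) := by
  refine coalitionLE_iff_tailCard.2 fun t => ?_
  rw [tailCard_insert hi, tailCard_insert hj]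
  have : (i : ℕ) ≤ j := hij
  split_ifs <;> omega

/-- A family of coalitions closed under supersets and under replacing a member by a larger
non-member is closed upwards in the coalitions poset. -/
theorem mem_of_coalitionLE {n : ℕ} {W : Set (Finset (Fin n))}
    (hmono : ∀ S R : Finset (Fin n), S ∈ W → S ⊆ R → R ∈ W)
    (hshift : ∀ i j : Fin n, i ≤ j → ∀ S : Finset (Fin n), i ∉ S → j ∉ S →
      insert i S ∈ W → insert j S ∈ W)
    {A B : Finset (Fin n)} (hB : B ∈ W) (h : CoalitionLE B A) : A ∈ W := by
  -- `S` collects the members of `A` already put in place. The largest remaining member of `B` is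
  -- exchanged for the largest remaining member of `A`; since `S` lies above both remainders, no
  -- exchange collides with it.
  have key : ∀ B A S : Finset (Fin n), (∀ t, tailCard B t ≤ tailCard A t) →
      (∀ s ∈ S, ∀ x ∈ B, x < s) → (∀ s ∈ S, ∀ x ∈ A, x < s) → S ∪ B ∈ W → S ∪ A ∈ W := by
    intro B
    induction B using Finset.induction_on_max with
    | empty =>
      intro A S _ _ _ h
      exact hmono _ _ h (Finset.union_subset_union_right (Finset.empty_subset _))
    | insert b B hb ih =>
      intro A S hBA hSB hSA hW
      have hbB : b ∉ B := fun hmem => lt_irrefl _ (hb b hmem)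
      have hne : (A.filter fun i : Fin n => (b : ℕ) ≤ (i : ℕ)).Nonempty := by
        rw [← Finset.card_pos]
        have := hBA b
        rw [tailCard_insert hbB, if_pos le_rfl] at this
        exact lt_of_lt_of_le (Nat.succ_pos _) this
      obtain ⟨c, hc⟩ := hne
      obtain ⟨hcA, hbc⟩ := Finset.mem_filter.1 hc
      have hA : A.Nonempty := ⟨c, hcA⟩
      set a := A.max' hA with ha
      have haA : a ∈ A := A.max'_mem hA
      have hba : b ≤ a := le_trans (show b ≤ c from hbc) (A.le_max' c hcA)
      have haS : a ∉ S := fun hmem => lt_irrefl _ (hSA a hmem a haA)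
      have hbS : b ∉ S := fun hmem => lt_irrefl _ (hSB b hmem b (Finset.mem_insert_self _ _))
      have haB : a ∉ B := fun hmem => not_lt.2 hba (hb a hmem)
      have h₁ : insert b (S ∪ B) ∈ W := by rwa [Finset.union_insert] at hW
      have h₂ : insert a (S ∪ B) ∈ W :=
        hshift b a hba _ (by simp [hbS, hbB]) (by simp [haS, haB]) h₁
      have h₃ := ih (A.erase a) (insert a S) ?_ ?_ ?_ (by rwa [Finset.insert_union])
      · rwa [Finset.insert_union, ← Finset.union_insert, Finset.insert_erase haA] at h₃
      · intro t
        have h₄ := hBA t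
        rw [← Finset.insert_erase haA, tailCard_insert hbB,
          tailCard_insert (Finset.notMem_erase _ _)] at h₄
        -- Up to `b` both tail counts drop by one; beyond `b` the rest of `B` has no members.
        by_cases htb : t ≤ (b : ℕ)
        · rw [if_pos htb, if_pos (htb.trans hba)] at h₄
          omega
        · have : tailCard B t = 0 := by
            refine Finset.card_eq_zero.2 (Finset.filter_eq_empty_iff.2 fun x hx => ?_)
            have : (x : ℕ) < b := hb x hx
            omega
          omega
      · intro s hs x hx
        rcases Finset.mem_insert.1 hs with rfl | hs
        · exact (hb x hx).trans_le hba
        · exact hSB s hs x (Finset.mem_insert_of_mem hx)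
      · intro s hs x hx
        obtain ⟨hxa, hxA⟩ := Finset.mem_erase.1 hx
        rcases Finset.mem_insert.1 hs with rfl | hs
        · exact lt_of_le_of_ne (A.le_max' x hxA) hxa
        · exact hSA s hs x hxA
  have := key B A ∅ (coalitionLE_iff_tailCard.1 h) (by simp) (by simp) (by simpa using hB)
  simpa using this

theorem LinearGame.mem_winning_of_coalitionLE {n : ℕ} (v : LinearGame n) {A B : Finset (Fin n)}
    (hB : B ∈ v.winning) (h : CoalitionLE B A) : A ∈ v.winning :=
  mem_of_coalitionLE v.mono (fun i j hij S hi hj => v.desirable i j hij S hj hi) hB h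

theorem sum_mono_of_monotone {n : ℕ} {w : Fin n → ℝ} (hpos : ∀ i, 0 ≤ w i)
    {S R : Finset (Fin n)} (h : S ⊆ R) : ∑ i ∈ S, w i ≤ ∑ i ∈ R, w i :=
  Finset.sum_le_sum_of_subset_of_nonneg h fun i _ _ => hpos i

/-- For such weights, the coalitions weighing at least as much as `B` are closed under supersets and
upward shifts. -/
theorem sum_le_sum_of_coalitionLE {n : ℕ} {w : Fin n → ℝ} (hw : Monotone w)
    (hpos : ∀ i, 0 ≤ w i) {A B : Finset (Fin n)} (h : CoalitionLE B A) :
    ∑ i ∈ B, w i ≤ ∑ i ∈ A, w i := by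
  refine mem_of_coalitionLE (W := {S | ∑ i ∈ B, w i ≤ ∑ i ∈ S, w i}) ?_ ?_ ?_ h
  · intro S R hS hSR
    exact le_trans hS (sum_mono_of_monotone hpos hSR)
  · intro i j hij S hi hj hS
    simp only [Set.mem_ofPred_eq, Finset.sum_insert hi, Finset.sum_insert hj] at hS ⊢
    linarith [hw hij]
  · exact le_refl (∑ i ∈ B, w i)

/-! ### Covering relations in `J_n` -/

theorem LinearGame.ext_winning {n : ℕ} {u v : LinearGame n} (h : u.winning = v.winning) :
    u = v :=
  le_antisymm h.ge h.le

/-- The game in which the shift-minimal winning coalition `A` has become losing. -/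
def LinearGame.remove {n : ℕ} (v : LinearGame n) (A : Finset (Fin n))
    (hA : A ∈ v.shiftMinimalWinning) (hne : A ≠ Finset.univ) : LinearGame n where
  winning := v.winning \ {A}
  univ_winning := ⟨v.univ_winning, fun h => hne h.symm⟩
  empty_losing h := v.empty_losing h.1
  mono := by
    rintro S R ⟨hS, hSA⟩ hSR
    refine ⟨v.mono S R hS hSR, ?_⟩
    rintro rfl
    exact hSA (hA.2 S hS (coalitionLE_of_subset hSR))
  desirable := by
    rintro i j hij S hj hi ⟨hS, hSA⟩
    refine ⟨v.desirable i j hij S hj hi hS, ?_⟩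
    intro hjA
    refine hSA (hA.2 _ hS ?_)
    rw [← Set.mem_singleton_iff.1 hjA]
    exact coalitionLE_insert hij hi hj

theorem LinearGame.covBy_of_winning_eq_diff {n : ℕ} {u v : LinearGame n} {A : Finset (Fin n)}
    (hA : A ∈ v.winning) (h : u.winning = v.winning \ {A}) : v ⋖ u := by
  refine ⟨lt_of_le_not_ge (show u.winning ⊆ v.winning by rw [h]; exact Set.sdiff_subset) ?_, ?_⟩
  · intro hle
    have : A ∈ u.winning := (show v.winning ⊆ u.winning from hle) hA
    rw [h] at this
    exact this.2 rfl
  · intro x hvx hxu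
    have h₁ : x.winning ⊆ v.winning := hvx.le
    have h₂ : u.winning ⊆ x.winning := hxu.le
    by_cases hAx : A ∈ x.winning
    · refine hvx.not_ge (show v.winning ⊆ x.winning from fun B hB => ?_)
      by_cases hBA : B = A
      · exact hBA ▸ hAx
      · exact h₂ (h ▸ ⟨hB, hBA⟩)
    · refine hxu.not_ge (show x.winning ⊆ u.winning from fun B hB => ?_)
      rw [h]
      exact ⟨h₁ hB, fun hBA => hAx ((Set.mem_singleton_iff.1 hBA) ▸ hB)⟩

/-- A coalition `A` minimal among those lost on passing from `v` to `u` is shift-minimal in `v`,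
because a smaller coalition winning in `u` would make `A` win there. Deleting only `A` gives a game
between `v` and `u`, which must be `u`. -/
theorem LinearGame.exists_shiftMinimal_of_covBy {n : ℕ} {u v : LinearGame n} (h : v ⋖ u) :
    ∃ A ∈ v.shiftMinimalWinning, A ≠ Finset.univ ∧ u.winning = v.winning \ {A} := by
  have huv : u.winning ⊆ v.winning := h.lt.le
  have hne : (v.winning \ u.winning).Nonempty := by
    by_contra hemp
    rw [Set.not_nonempty_iff_eq_empty, Set.sdiff_eq_empty] at hemp
    exact h.lt.not_ge hemp
  obtain ⟨A, ⟨hAv, hAu⟩, hmin⟩ := (Set.toFinite (v.winning \ u.winning)).exists_minimalFor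
    (fun A => tailCard A) _ hne
  have hA : A ∈ v.shiftMinimalWinning := by
    refine ⟨hAv, fun B hB hBA => ?_⟩
    have hBu : B ∉ u.winning := fun hBu => hAu (u.mem_winning_of_coalitionLE hBu hBA)
    exact hBA.antisymm (coalitionLE_iff_tailCard.2
      (hmin ⟨hB, hBu⟩ (coalitionLE_iff_tailCard.1 hBA)))
  have hAne : A ≠ Finset.univ := fun hA => hAu (hA ▸ u.univ_winning)
  refine ⟨A, hA, hAne, ?_⟩
  by_contra hneq
  have hsub : u.winning ⊆ v.winning \ {A} :=
    fun B hB => ⟨huv hB, fun hBA => hAu ((Set.mem_singleton_iff.1 hBA) ▸ hB)⟩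
  have hlt : v < v.remove A hA hAne := (covBy_of_winning_eq_diff hAv rfl).lt
  refine h.2 hlt (lt_of_le_of_ne hsub fun heq => hneq ?_)
  rw [← heq]
  rfl

/-! ### Linear forms, strict realizations and the closure of the polytope -/

/-- The linear form `(q, w) ↦ q - ∑ i ∈ A, w i`. -/
noncomputable def coalitionForm {n : ℕ} (A : Finset (Fin n)) : (ℝ × (Fin n → ℝ)) →L[ℝ] ℝ :=
  ContinuousLinearMap.fst ℝ ℝ (Fin n → ℝ) -
    ∑ i ∈ A, (ContinuousLinearMap.proj i).comp (ContinuousLinearMap.snd ℝ ℝ (Fin n → ℝ))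

@[simp]
theorem coalitionForm_apply {n : ℕ} (A : Finset (Fin n)) (p : ℝ × (Fin n → ℝ)) :
    coalitionForm A p = p.1 - ∑ i ∈ A, p.2 i := by
  simp [coalitionForm]

/-- The linear form `(q, w) ↦ ∑ i, w i`. -/
noncomputable def totalForm (n : ℕ) : (ℝ × (Fin n → ℝ)) →L[ℝ] ℝ :=
  ∑ i, (ContinuousLinearMap.proj i).comp (ContinuousLinearMap.snd ℝ ℝ (Fin n → ℝ))

@[simp]
theorem totalForm_apply {n : ℕ} (p : ℝ × (Fin n → ℝ)) : totalForm n p = ∑ i, p.2 i := by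
  simp [totalForm]

theorem mem_coalitionHyperplane {n : ℕ} {A : Finset (Fin n)} {p : ℝ × (Fin n → ℝ)} :
    p ∈ coalitionHyperplane A ↔ coalitionForm A p = 0 := by
  simp [coalitionHyperplane, sub_eq_zero]

/-- Outside the set `T` of coalitions, `p` realizes `v` strictly. -/
def SimpleGame.Separates {n : ℕ} (v : SimpleGame n) (T : Set (Finset (Fin n)))
    (p : ℝ × (Fin n → ℝ)) : Prop :=
  ∀ B ∉ T, (B ∈ v.winning → coalitionForm B p < 0) ∧ (B ∉ v.winning → 0 < coalitionForm B p)

/-- The strictly increasing positive weights. -/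
def strictWeights (n : ℕ) : Set (Fin n → ℝ) := {w | StrictMono w ∧ ∀ i, 0 < w i}

/-- Some normalized point of `h_A` realizes `v` strictly, except at `A`. -/
def SimpleGame.HasWall {n : ℕ} (v : SimpleGame n) (A : Finset (Fin n)) : Prop :=
  ∃ p : ℝ × (Fin n → ℝ), p.2 ∈ normalizedWeights n ∧ coalitionForm A p = 0 ∧ v.Separates {A} p

theorem mem_normalizedWeights_of_strict {n : ℕ} {w : Fin n → ℝ} (hw : w ∈ strictWeights n)
    (hsum : ∑ i, w i = 1) : w ∈ normalizedWeights n :=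
  ⟨hw.1.monotone, fun i => (hw.2 i).le, hsum⟩

/-- The bounds on the quota are automatic: the empty coalition loses and the grand coalition, of
weight one, wins. -/
theorem LinearGame.mem_polytope_iff {n : ℕ} {v : LinearGame n} {p : ℝ × (Fin n → ℝ)} :
    p ∈ v.polytope ↔ p.2 ∈ normalizedWeights n ∧
      ∀ A, A ∈ v.winning ↔ coalitionForm A p ≤ 0 := by
  simp only [polytope, configRegion, Set.mem_ofPred_eq, Set.mem_prod, Set.mem_Ioc,
    coalitionForm_apply, sub_nonpos]
  refine ⟨fun h => ⟨h.1.2, h.2⟩, fun h => ⟨⟨⟨?_, ?_⟩, h.1⟩, h.2⟩⟩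
  · by_contra! hq
    exact v.empty_losing ((h.2 ∅).2 (by simpa using hq))
  · rw [← h.1.2.2]
    exact (h.2 _).1 v.univ_winning

theorem LinearGame.mem_polytope_of_separates {n : ℕ} {v : LinearGame n} {p : ℝ × (Fin n → ℝ)}
    (hp : p.2 ∈ normalizedWeights n) (h : v.Separates ∅ p) : p ∈ v.polytope := by
  refine mem_polytope_iff.2 ⟨hp, fun A => ⟨fun hA => ((h A (by simp)).1 hA).le, fun hA => ?_⟩⟩
  by_contra hA'
  exact absurd ((h A (by simp)).2 hA') (not_lt.2 hA)

theorem isClosed_normalizedWeights (n : ℕ) : IsClosed (normalizedWeights n) := by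
  have : normalizedWeights n = {w : Fin n → ℝ | Monotone w} ∩
      ({w | ∀ i, 0 ≤ w i} ∩ {w | ∑ i, w i = 1}) := rfl
  rw [this]
  refine isClosed_monotone.inter (IsClosed.inter ?_ ?_)
  · simp only [Set.ofPred_forall]
    exact isClosed_iInter fun i => isClosed_le continuous_const (continuous_apply i)
  · exact isClosed_eq (by fun_prop) continuous_const

theorem LinearGame.mem_closure_polytope {n : ℕ} {v : LinearGame n} {p : ℝ × (Fin n → ℝ)}
    (hp : p ∈ closure v.polytope) : p.2 ∈ normalizedWeights n ∧
      ∀ A, (A ∈ v.winning → coalitionForm A p ≤ 0) ∧ (A ∉ v.winning → 0 ≤ coalitionForm A p) := by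
  refine ⟨?_, fun A => ⟨fun hA => ?_, fun hA => ?_⟩⟩
  · exact closure_minimal (fun x hx => (mem_polytope_iff.1 hx).1)
      ((isClosed_normalizedWeights n).preimage continuous_snd) hp
  · exact closure_minimal (t := {x | coalitionForm A x ≤ 0})
      (fun x hx => ((mem_polytope_iff.1 hx).2 A).1 hA)
      (isClosed_le (coalitionForm A).continuous continuous_const) hp
  · refine closure_minimal (t := {x | 0 ≤ coalitionForm A x}) (fun x hx => ?_)
      (isClosed_le continuous_const (coalitionForm A).continuous) hp
    by_contra hlt
    exact hA (((mem_polytope_iff.1 hx).2 A).2 (not_le.1 hlt).le)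

theorem isOpen_strictWeights (n : ℕ) : IsOpen (strictWeights n) := by
  have : strictWeights n = (⋂ i, ⋂ j, {w : Fin n → ℝ | i < j → w i < w j}) ∩
      ⋂ i, {w | 0 < w i} := by
    ext w
    simp [strictWeights, StrictMono]
  rw [this]
  refine IsOpen.inter ?_ ?_
  · refine isOpen_iInter_of_finite fun i => isOpen_iInter_of_finite fun j => ?_
    by_cases h : i < j
    · simpa [h] using isOpen_lt (continuous_apply i) (continuous_apply j)
    · simp [h]
  · exact isOpen_iInter_of_finite fun i => isOpen_lt continuous_const (continuous_apply i)

theorem SimpleGame.isOpen_separates {n : ℕ} (v : SimpleGame n) (T : Set (Finset (Fin n))) :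
    IsOpen {p | v.Separates T p} := by
  have : {p | v.Separates T p} = ⋂ B, {p | B ∉ T →
      (B ∈ v.winning → coalitionForm B p < 0) ∧ (B ∉ v.winning → 0 < coalitionForm B p)} := by
    ext p
    simp only [Set.mem_iInter]
    rfl
  rw [this]
  refine isOpen_iInter_of_finite fun B => ?_
  by_cases hT : B ∈ T
  · simp only [hT, not_true_eq_false, false_imp_iff]
    exact isOpen_univ
  · by_cases hB : B ∈ v.winning
    · simp only [hT, hB, not_true_eq_false, not_false_eq_true, false_imp_iff, true_imp_iff,
        and_true]
      exact isOpen_lt (coalitionForm B).continuous continuous_const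
    · simp only [hT, hB, not_false_eq_true, false_imp_iff, true_imp_iff, true_and]
      exact isOpen_lt continuous_const (coalitionForm B).continuous

theorem exists_strictWeights {n : ℕ} (hn : 0 < n) :
    ∃ w ∈ strictWeights n, ∑ i, w i = 1 := by
  have : Nonempty (Fin n) := ⟨⟨0, hn⟩⟩
  set s : ℝ := ∑ i : Fin n, ((i : ℕ) + 1 : ℝ)
  have hs : 0 < s := Finset.sum_pos (fun i _ => by positivity) Finset.univ_nonempty
  refine ⟨fun i => ((i : ℕ) + 1 : ℝ) / s, ⟨fun i j hij => ?_, fun i => by positivity⟩, ?_⟩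
  · have : ((i : ℕ) : ℝ) < (j : ℕ) := by exact_mod_cast hij
    dsimp only
    gcongr
  · rw [← Finset.sum_div]
    exact div_self hs.ne'

/-- Moving slightly towards a point with strict weights makes the weights strict. -/
theorem SimpleGame.Separates.exists_strict {n : ℕ} {v : SimpleGame n} {T : Set (Finset (Fin n))}
    {p r : ℝ × (Fin n → ℝ)} (h : v.Separates T p) (hp : p.2 ∈ normalizedWeights n)
    (hr : r.2 ∈ strictWeights n) (hsum : ∑ i, r.2 i = 1) :
    ∃ p' : ℝ × (Fin n → ℝ), p'.2 ∈ strictWeights n ∧ ∑ i, p'.2 i = 1 ∧ v.Separates T p' ∧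
      ∀ A, coalitionForm A p = 0 → coalitionForm A r = 0 → coalitionForm A p' = 0 := by
  have hcont : Tendsto (fun t : ℝ => p + t • (r - p)) (𝓝[>] 0) (𝓝 p) := by
    have : Tendsto (fun t : ℝ => p + t • (r - p)) (𝓝 0) (𝓝 (p + (0 : ℝ) • (r - p))) :=
      Continuous.tendsto (by fun_prop) 0
    rw [zero_smul, add_zero] at this
    exact this.mono_left nhdsWithin_le_nhds
  have h₁ := hcont.eventually ((v.isOpen_separates T).mem_nhds h)
  have h₂ : ∀ᶠ t : ℝ in 𝓝[>] 0, t ∈ Set.Ioo (0 : ℝ) 1 := Ioo_mem_nhdsGT one_pos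
  obtain ⟨t, hsep, ht0, ht1⟩ := (h₁.and h₂).exists
  refine ⟨_, ⟨fun i j hij => ?_, fun i => ?_⟩, ?_, hsep, fun A hA hA' => ?_⟩
  · have h₃ := hp.1 hij.le
    have h₄ := hr.1 hij
    simp only [Prod.snd_add, Prod.smul_snd, Prod.snd_sub, Pi.add_apply, Pi.smul_apply,
      Pi.sub_apply, smul_eq_mul]
    nlinarith
  · have h₃ := hp.2.1 i
    have h₄ := hr.2 i
    simp only [Prod.snd_add, Prod.smul_snd, Prod.snd_sub, Pi.add_apply, Pi.smul_apply,
      Pi.sub_apply, smul_eq_mul]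
    nlinarith
  · have h₃ := hp.2.2
    rw [← totalForm_apply] at hsum h₃ ⊢
    simp [-totalForm_apply, hsum, h₃]
  · simp [-coalitionForm_apply, hA, hA']

/-! ### Dimensions, and the facet cut out by a wall -/

theorem le_vectorSpan_of_eventually {E : Type*} [AddCommGroup E] [Module ℝ E]
    {V : Submodule ℝ E} {P : Set E} {p : E} (hp : p ∈ P)
    (h : ∀ x ∈ V, ∀ᶠ t : ℝ in 𝓝[>] 0, p + t • x ∈ P) : V ≤ vectorSpan ℝ P := by
  intro x hx
  obtain ⟨t, htP, ht⟩ := ((h x hx).and self_mem_nhdsWithin).exists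
  have hmem := vsub_mem_vectorSpan ℝ htP hp
  rw [vsub_eq_sub, add_sub_cancel_left] at hmem
  exact (Submodule.smul_mem_iff _ (ne_of_gt ht)).1 hmem

theorem vectorSpan_le_ker {E : Type*} [AddCommGroup E] [Module ℝ E] {φ : E →ₗ[ℝ] ℝ} {P : Set E}
    {c : ℝ} (h : ∀ x ∈ P, φ x = c) : vectorSpan ℝ P ≤ LinearMap.ker φ := by
  refine Submodule.span_le.2 ?_
  rintro _ ⟨x, hx, y, hy, rfl⟩
  simp [h x hx, h y hy]

theorem finrank_inf_ker_add_one {E : Type*} [AddCommGroup E] [Module ℝ E]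
    [FiniteDimensional ℝ E] {V : Submodule ℝ E} {φ : E →ₗ[ℝ] ℝ} {x : E} (hx : x ∈ V)
    (hφ : φ x ≠ 0) : Module.finrank ℝ ↥(V ⊓ LinearMap.ker φ) + 1 = Module.finrank ℝ V := by
  have h₁ := (φ.comp V.subtype).finrank_range_add_finrank_ker
  have h₂ : LinearMap.range (φ.comp V.subtype) = ⊤ :=
    LinearMap.range_eq_top.2 (LinearMap.surjective_iff_ne_zero.2 fun h =>
      hφ (by simpa using LinearMap.congr_fun h ⟨x, hx⟩))
  have h₃ : (LinearMap.ker (φ.comp V.subtype)).map V.subtype = V ⊓ LinearMap.ker φ := by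
    rw [LinearMap.ker_comp, Submodule.map_comap_subtype]
  rw [h₂, finrank_top, Module.finrank_self] at h₁
  rw [← h₃, LinearEquiv.finrank_eq (Submodule.equivSubtypeMap _ _).symm]
  omega

/-- The directions of the affine space of the points of `h_A` with weights of sum one. -/
noncomputable def wallDirections {n : ℕ} (A : Finset (Fin n)) :
    Submodule ℝ (ℝ × (Fin n → ℝ)) :=
  LinearMap.ker (totalForm n : (ℝ × (Fin n → ℝ)) →ₗ[ℝ] ℝ) ⊓
    LinearMap.ker (coalitionForm A : (ℝ × (Fin n → ℝ)) →ₗ[ℝ] ℝ)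

theorem mem_wallDirections {n : ℕ} {A : Finset (Fin n)} {x : ℝ × (Fin n → ℝ)} :
    x ∈ wallDirections A ↔ totalForm n x = 0 ∧ coalitionForm A x = 0 := by
  simp [wallDirections]

theorem finrank_wallDirections {n : ℕ} (A : Finset (Fin n)) :
    Module.finrank ℝ (wallDirections A) + 1 =
      Module.finrank ℝ (LinearMap.ker (totalForm n : (ℝ × (Fin n → ℝ)) →ₗ[ℝ] ℝ)) :=
  -- The pure quota direction has total weight zero, but the form of `A` is one on it.
  finrank_inf_ker_add_one (x := (1, 0)) (by simp) (by simp)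

theorem eventually_add_smul_mem {E : Type*} [AddCommGroup E] [Module ℝ E] [TopologicalSpace E]
    [ContinuousAdd E] [ContinuousSMul ℝ E] {U : Set E} (hU : IsOpen U) {p : E} (hp : p ∈ U)
    (x : E) : ∀ᶠ t : ℝ in 𝓝[>] 0, p + t • x ∈ U := by
  have : Tendsto (fun t : ℝ => p + t • x) (𝓝 0) (𝓝 (p + (0 : ℝ) • x)) :=
    Continuous.tendsto (by fun_prop) 0
  rw [zero_smul, add_zero] at this
  exact (this.mono_left nhdsWithin_le_nhds).eventually (hU.mem_nhds hp)

theorem LinearGame.vectorSpan_le_of_subset {n : ℕ} {v : LinearGame n}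
    {P : Set (ℝ × (Fin n → ℝ))} (hP : P ⊆ closure v.polytope) :
    vectorSpan ℝ P ≤ LinearMap.ker (totalForm n : (ℝ × (Fin n → ℝ)) →ₗ[ℝ] ℝ) :=
  vectorSpan_le_ker (c := 1) fun x hx => by simpa using (mem_closure_polytope (hP hx)).1.2.2

/-- Strict realization and strict weights are open conditions, so from `p` one can move a little in
any direction of total weight zero without leaving the polytope. -/
theorem LinearGame.vectorSpan_polytope {n : ℕ} {v : LinearGame n} {p : ℝ × (Fin n → ℝ)}
    (hw : p.2 ∈ strictWeights n) (hsum : ∑ i, p.2 i = 1) (hp : v.Separates ∅ p) :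
    vectorSpan ℝ v.polytope = LinearMap.ker (totalForm n : (ℝ × (Fin n → ℝ)) →ₗ[ℝ] ℝ) := by
  refine le_antisymm (vectorSpan_le_of_subset subset_closure) (le_vectorSpan_of_eventually
    (mem_polytope_of_separates (mem_normalizedWeights_of_strict hw hsum) hp) fun x hx => ?_)
  filter_upwards [eventually_add_smul_mem (v.isOpen_separates ∅) hp x,
    eventually_add_smul_mem ((isOpen_strictWeights n).preimage continuous_snd) hw x] with t h₁ h₂
  refine mem_polytope_of_separates (mem_normalizedWeights_of_strict h₂ ?_) h₁
  have hx' : totalForm n x = 0 := hx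
  rw [← totalForm_apply] at hsum ⊢
  simp [-totalForm_apply, hsum, hx']

/-- Lowering the quota if `A` wins, or raising it if `A` loses, makes `A` strict too; the other
inequalities survive small moves. -/
theorem SimpleGame.Separates.exists_eventually_separates {n : ℕ} {v : SimpleGame n}
    {A : Finset (Fin n)} {p : ℝ × (Fin n → ℝ)} (hp : v.Separates {A} p)
    (hA : coalitionForm A p = 0) :
    ∃ s : ℝ, ∀ᶠ t : ℝ in 𝓝[>] 0, v.Separates ∅ (p + t • (s, 0)) := by
  classical
  refine ⟨if A ∈ v.winning then -1 else 1, ?_⟩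
  filter_upwards [eventually_add_smul_mem (v.isOpen_separates {A}) hp _,
    self_mem_nhdsWithin] with t ht ht0 B _
  by_cases hBA : B = A
  · subst hBA
    have h0 : (0 : ℝ) < t := ht0
    rw [map_add, hA]
    split_ifs with h <;> simp [h, h0]
  · exact ht B hBA

theorem LinearGame.mem_closure_of_wall {n : ℕ} {v : LinearGame n} {A : Finset (Fin n)}
    {p : ℝ × (Fin n → ℝ)} (hw : p.2 ∈ normalizedWeights n) (hA : coalitionForm A p = 0)
    (hp : v.Separates {A} p) : p ∈ closure v.polytope := by
  obtain ⟨s, hs⟩ := hp.exists_eventually_separates hA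
  have : Tendsto (fun t : ℝ => p + t • ((s, 0) : ℝ × (Fin n → ℝ))) (𝓝 0)
      (𝓝 (p + (0 : ℝ) • ((s, 0) : ℝ × (Fin n → ℝ)))) :=
    Continuous.tendsto (by fun_prop) 0
  rw [zero_smul, add_zero] at this
  refine mem_closure_of_tendsto (this.mono_left (nhdsWithin_le_nhds (s := Set.Ioi 0))) ?_
  filter_upwards [hs] with t ht
  exact mem_polytope_of_separates (by simpa using hw) ht

theorem LinearGame.pos {n : ℕ} (v : LinearGame n) : 0 < n := by
  rcases Nat.eq_zero_or_pos n with rfl | h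
  · exact absurd v.univ_winning v.empty_losing
  · exact h

theorem LinearGame.isFacet_of_hasWall {n : ℕ} {v : LinearGame n} {A : Finset (Fin n)}
    (h : v.HasWall A) : IsFacet v.polytope (closure v.polytope ∩ coalitionHyperplane A) := by
  obtain ⟨p₀, hw₀, hA₀, hp₀⟩ := h
  obtain ⟨r, hr, hrsum⟩ := exists_strictWeights v.pos
  -- The quota of the auxiliary point is chosen to put it on `h_A`, so the perturbation stays on the
  -- wall.
  obtain ⟨p, hw, hsum, hp, hpA⟩ := hp₀.exists_strict hw₀ (r := (∑ i ∈ A, r i, r)) hr hrsum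
  have hA : coalitionForm A p = 0 := hpA A hA₀ (by simp)
  have hpF : p ∈ closure v.polytope ∩ coalitionHyperplane A :=
    ⟨mem_closure_of_wall (mem_normalizedWeights_of_strict hw hsum) hA hp,
      mem_coalitionHyperplane.2 hA⟩
  refine ⟨⟨p, hpF⟩, fun _ => ?_, ?_⟩
  -- Up to sign, the form of `A` is the exposing functional: it is nonpositive on the closure and
  -- vanishes at `p`.
  · have key : ∀ l : (ℝ × (Fin n → ℝ)) →L[ℝ] ℝ, (∀ x, l x = 0 ↔ coalitionForm A x = 0) →
        (∀ x ∈ closure v.polytope, l x ≤ 0) → closure v.polytope ∩ coalitionHyperplane A =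
          {x ∈ closure v.polytope | ∀ y ∈ closure v.polytope, l y ≤ l x} := by
      intro l hl hle
      ext x
      refine and_congr_right fun hx => ?_
      rw [mem_coalitionHyperplane, ← hl]
      exact ⟨fun h0 y hy => h0 ▸ hle y hy,
        fun hmax => (hle x hx).antisymm (((hl p).2 hA).ge.trans (hmax p hpF.1))⟩
    by_cases hAv : A ∈ v.winning
    · exact ⟨coalitionForm A, key _ (fun x => Iff.rfl) fun x hx =>
        ((mem_closure_polytope hx).2 A).1 hAv⟩
    · exact ⟨-coalitionForm A, key _ (fun x => by simp only [neg_apply, neg_eq_zero]) fun x hx => by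
        simpa only [neg_apply, neg_nonpos] using ((mem_closure_polytope hx).2 A).2 hAv⟩
  · have hF : vectorSpan ℝ (closure v.polytope ∩ coalitionHyperplane A) = wallDirections A := by
      refine le_antisymm (le_inf (vectorSpan_le_of_subset Set.inter_subset_left)
        (vectorSpan_le_ker fun x hx => mem_coalitionHyperplane.1 hx.2))
        (le_vectorSpan_of_eventually hpF fun x hx => ?_)
      obtain ⟨hx₁, hx₂⟩ := mem_wallDirections.1 hx
      filter_upwards [eventually_add_smul_mem (v.isOpen_separates {A}) hp x,
        eventually_add_smul_mem ((isOpen_strictWeights n).preimage continuous_snd) hw x]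
        with t h₁ h₂
      have h₃ : coalitionForm A (p + t • x) = 0 := by
        simp [-coalitionForm_apply, hA, hx₂]
      refine ⟨mem_closure_of_wall (mem_normalizedWeights_of_strict h₂ ?_) h₃ h₁,
        mem_coalitionHyperplane.2 h₃⟩
      rw [← totalForm_apply] at hsum ⊢
      simp [-totalForm_apply, hsum, hx₁]
    obtain ⟨s, hs⟩ := hp.exists_eventually_separates hA
    obtain ⟨t, ht⟩ := hs.exists
    rw [hF, vectorSpan_polytope (by simpa using hw) (by simpa using hsum) ht,
      finrank_wallDirections]

theorem LinearGame.exists_strict_separates {n : ℕ} {v : LinearGame n} {p : ℝ × (Fin n → ℝ)}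
    (hw : p.2 ∈ normalizedWeights n) (hp : v.Separates ∅ p) :
    ∃ p' : ℝ × (Fin n → ℝ), p'.2 ∈ strictWeights n ∧ ∑ i, p'.2 i = 1 ∧ v.Separates ∅ p' := by
  obtain ⟨r, hr, hrsum⟩ := exists_strictWeights v.pos
  obtain ⟨p', h₁, h₂, h₃, _⟩ := hp.exists_strict hw (r := (0, r)) hr hrsum
  exact ⟨p', h₁, h₂, h₃⟩

/-! ### Every facet in a coalition hyperplane comes from a unique wall -/

section Facet

variable {n : ℕ} {v : LinearGame n} {A B : Finset (Fin n)} {F G : Set (ℝ × (Fin n → ℝ))}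
  {p : ℝ × (Fin n → ℝ)}

theorem IsFacet.subset_closure_polytope (hF : IsFacet v.polytope F) :
    F ⊆ closure v.polytope := by
  obtain ⟨l, hl⟩ := hF.2.1 hF.1
  rw [hl]
  exact fun x hx => hx.1

theorem IsFacet.vectorSpan_eq (hw : p.2 ∈ normalizedWeights n) (hp : v.Separates ∅ p)
    (hF : IsFacet v.polytope F) (hA : F ⊆ coalitionHyperplane A) :
    vectorSpan ℝ F = wallDirections A := by
  obtain ⟨p', h₁, h₂, h₃⟩ := LinearGame.exists_strict_separates hw hp
  refine Submodule.eq_of_le_of_finrank_eq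
    (le_inf (LinearGame.vectorSpan_le_of_subset hF.subset_closure_polytope)
      (vectorSpan_le_ker fun x hx => mem_coalitionHyperplane.1 (hA hx))) ?_
  have h := hF.2.2
  rw [LinearGame.vectorSpan_polytope h₁ h₂ h₃, ← finrank_wallDirections A] at h
  omega

theorem IsFacet.coalition_unique (hw : p.2 ∈ normalizedWeights n) (hp : v.Separates ∅ p)
    (hF : IsFacet v.polytope F) (hA : F ⊆ coalitionHyperplane A)
    (hB : F ⊆ coalitionHyperplane B) : A = B := by
  obtain ⟨x, hx⟩ := hF.1
  have hsum := (LinearGame.mem_closure_polytope (hF.subset_closure_polytope hx)).1.2.2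
  have hAB := (hF.vectorSpan_eq hw hp hA).symm.trans (hF.vectorSpan_eq hw hp hB)
  have hxA := mem_coalitionHyperplane.1 (hA hx)
  have hxB := mem_coalitionHyperplane.1 (hB hx)
  ext i
  -- Move the weights of `x` towards the unit weight at `i`, adjusting the quota to stay in `h_A`.
  -- Since `A` and `B` weigh the same at `x`, staying in `h_B` as well forces `i` into both or
  -- neither.
  set y : Fin n → ℝ := Pi.single i 1 - x.2 with hy
  have hmem : ((∑ j ∈ A, y j, y) : ℝ × (Fin n → ℝ)) ∈ wallDirections A :=
    mem_wallDirections.2 ⟨by simp [hy, hsum], by simp⟩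
  rw [hAB, mem_wallDirections] at hmem
  have h := hmem.2
  simp only [coalitionForm_apply, hy, Pi.sub_apply, Finset.sum_sub_distrib, Pi.single_apply,
    Finset.sum_ite_eq'] at h hxA hxB
  by_cases h₁ : i ∈ A <;> by_cases h₂ : i ∈ B <;> simp [h₁, h₂] at h ⊢ <;> linarith

/-- The exposing functional is constant on `F`, hence kills all directions of `h_A` of total weight
zero. Every point of the closure on `h_A` therefore maximizes it too. -/
theorem IsFacet.eq_of_subset (hw : p.2 ∈ normalizedWeights n) (hp : v.Separates ∅ p)
    (hF : IsFacet v.polytope F) (hA : F ⊆ coalitionHyperplane A) :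
    F = closure v.polytope ∩ coalitionHyperplane A := by
  refine Set.Subset.antisymm (Set.subset_inter hF.subset_closure_polytope hA) fun x hx => ?_
  obtain ⟨y, hy⟩ := hF.1
  obtain ⟨l, hl⟩ := hF.2.1 hF.1
  have hmax : ∀ z ∈ F, (l : (ℝ × (Fin n → ℝ)) →ₗ[ℝ] ℝ) z = l y := by
    intro z hz
    rw [hl] at hz hy
    exact le_antisymm (hy.2 z hz.1) (hz.2 y hy.1)
  have hxy : x - y ∈ wallDirections A := by
    have h₁ := (LinearGame.mem_closure_polytope hx.1).1.2.2
    have h₂ := (LinearGame.mem_closure_polytope (hF.subset_closure_polytope hy)).1.2.2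
    rw [← totalForm_apply] at h₁ h₂
    rw [mem_wallDirections, map_sub, map_sub, h₁, h₂, mem_coalitionHyperplane.1 hx.2,
      mem_coalitionHyperplane.1 (hA hy)]
    simp
  rw [← hF.vectorSpan_eq hw hp hA] at hxy
  have h0 : l x - l y = 0 := by simpa using vectorSpan_le_ker hmax hxy
  have hxl : l x = l y := sub_eq_zero.1 h0
  rw [hl] at hy ⊢
  exact ⟨hx.1, fun z hz => hxl ▸ hy.2 z hz⟩

/-- By uniqueness, `F` has a point off `h_B` for each `B ≠ A`. In the average of these points every
weak inequality with `B ≠ A` has become strict. -/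
theorem IsFacet.hasWall (hw : p.2 ∈ normalizedWeights n) (hp : v.Separates ∅ p)
    (hF : IsFacet v.polytope F) (hA : F ⊆ coalitionHyperplane A) : v.HasWall A := by
  have hex : ∀ B : Finset (Fin n), ∃ x ∈ F, B ≠ A → coalitionForm B x ≠ 0 := by
    intro B
    by_cases hBA : B = A
    · exact hF.1.imp fun x hx => ⟨hx, fun h => absurd hBA h⟩
    · by_contra! hcon
      exact hBA (hF.coalition_unique hw hp (fun x hx => mem_coalitionHyperplane.2 (hcon x hx).2) hA)
  choose f hfF hf using hex
  have hcl : ∀ B, f B ∈ closure v.polytope := fun B => hF.subset_closure_polytope (hfF B)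
  set c : ℝ := (Fintype.card (Finset (Fin n)) : ℝ)⁻¹ with hc
  have hc0 : 0 < c := by positivity
  set m : ℝ × (Fin n → ℝ) := c • ∑ B, f B with hm
  have hm2 : ∀ i, m.2 i = c * ∑ B, (f B).2 i := by
    intro i
    simp [hm, Prod.snd_sum]
  have hform : ∀ B, coalitionForm B m = c * ∑ C, coalitionForm B (f C) := by
    intro B
    simp only [hm, map_smul, map_sum, smul_eq_mul]
  refine ⟨m, ⟨?_, ?_, ?_⟩, ?_, fun B hB => ⟨fun hBv => ?_, fun hBv => ?_⟩⟩
  · intro i j hij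
    rw [hm2, hm2]
    gcongr with B
    exact (LinearGame.mem_closure_polytope (hcl B)).1.1 hij
  · intro i
    rw [hm2]
    exact mul_nonneg hc0.le (Finset.sum_nonneg fun B _ =>
      (LinearGame.mem_closure_polytope (hcl B)).1.2.1 i)
  · have h1 : ∀ B, totalForm n (f B) = 1 := fun B => by
      simpa using (LinearGame.mem_closure_polytope (hcl B)).1.2.2
    rw [← totalForm_apply, hm, map_smul, map_sum, Finset.sum_congr rfl fun B _ => h1 B]
    simp [hc]
  · rw [hform, Finset.sum_eq_zero fun C _ => mem_coalitionHyperplane.1 (hA (hfF C)), mul_zero]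
  · rw [hform]
    refine mul_neg_of_pos_of_neg hc0 (Finset.sum_neg' (fun C _ =>
      ((LinearGame.mem_closure_polytope (hcl C)).2 B).1 hBv) ⟨B, Finset.mem_univ _, ?_⟩)
    exact lt_of_le_of_ne (((LinearGame.mem_closure_polytope (hcl B)).2 B).1 hBv) (hf B hB)
  · rw [hform]
    refine mul_pos hc0 (Finset.sum_pos' (fun C _ =>
      ((LinearGame.mem_closure_polytope (hcl C)).2 B).2 hBv) ⟨B, Finset.mem_univ _, ?_⟩)
    exact lt_of_le_of_ne (((LinearGame.mem_closure_polytope (hcl B)).2 B).2 hBv) (hf B hB).symm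

theorem LinearGame.encard_facets (hw : p.2 ∈ normalizedWeights n) (hp : v.Separates ∅ p)
    (Q : Set (Finset (Fin n))) :
    {F | IsFacet v.polytope F ∧ ∃ A, A ∈ Q ∧ F ⊆ coalitionHyperplane A}.encard =
      {A | A ∈ Q ∧ v.HasWall A}.encard := by
  have h : {F | IsFacet v.polytope F ∧ ∃ A, A ∈ Q ∧ F ⊆ coalitionHyperplane A} =
      (fun A => closure v.polytope ∩ coalitionHyperplane A) '' {A | A ∈ Q ∧ v.HasWall A} := by
    ext F
    constructor
    · rintro ⟨hF, A, hAQ, hA⟩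
      exact ⟨A, ⟨hAQ, hF.hasWall hw hp hA⟩, (hF.eq_of_subset hw hp hA).symm⟩
    · rintro ⟨A, ⟨hAQ, hA⟩, rfl⟩
      exact ⟨isFacet_of_hasWall hA, A, hAQ, Set.inter_subset_right⟩
  rw [h]
  refine Set.InjOn.encard_image fun A hA B hB hAB => ?_
  refine (isFacet_of_hasWall hA.2).coalition_unique hw hp Set.inter_subset_right ?_
  exact (show _ ∩ _ = _ ∩ _ from hAB).le.trans Set.inter_subset_right

end Facet

/-! ### Normalized strict realizations of weighted games -/

theorem LinearGame.insert_mem_iff_of_lt {n : ℕ} {v : LinearGame n} {q : ℝ} {w : Fin n → ℝ}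
    (h : ∀ A, A ∈ v.winning ↔ q ≤ ∑ k ∈ A, w k) {i j : Fin n} (hij : i ≤ j) (hw : w j ≤ w i)
    {S : Finset (Fin n)} (hi : i ∉ S) (hj : j ∉ S) :
    insert i S ∈ v.winning ↔ insert j S ∈ v.winning := by
  refine ⟨v.desirable i j hij S hj hi, fun hS => ?_⟩
  rw [h, Finset.sum_insert hj] at hS
  rw [h, Finset.sum_insert hi]
  linarith

/-- If weights contradict the labelling, the weights give one desirability comparison and linearity
the other. The two voters are then interchangeable, and so are their weights. -/
theorem LinearGame.realizes_comp_swap {n : ℕ} {v : LinearGame n} {q : ℝ} {w : Fin n → ℝ}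
    (h : ∀ A, A ∈ v.winning ↔ q ≤ ∑ k ∈ A, w k) {i j : Fin n} (hij : i < j) (hw : w j ≤ w i)
    (A : Finset (Fin n)) : A ∈ v.winning ↔ q ≤ ∑ k ∈ A, w (Equiv.swap i j k) := by
  have key : ∀ a b : Fin n, ∀ S : Finset (Fin n), a ≠ b → a ∉ S → b ∉ S →
      ∑ k ∈ insert a S, w (Equiv.swap a b k) = ∑ k ∈ insert b S, w k := by
    intro a b S hab ha hb
    rw [Finset.sum_insert ha, Finset.sum_insert hb, Equiv.swap_apply_left]
    congr 1
    refine Finset.sum_congr rfl fun k hk => ?_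
    rw [Equiv.swap_apply_of_ne_of_ne (ne_of_mem_of_not_mem hk ha) (ne_of_mem_of_not_mem hk hb)]
  by_cases hi : i ∈ A <;> by_cases hj : j ∈ A
  · rw [h]
    have : A.map (Equiv.swap i j).toEmbedding = A := by
      ext k
      rw [Finset.mem_map_equiv, Equiv.symm_swap]
      rcases eq_or_ne k i with rfl | hki
      · simp [hi, hj]
      · rcases eq_or_ne k j with rfl | hkj
        · simp [hi, hj]
        · rw [Equiv.swap_apply_of_ne_of_ne hki hkj]
    conv_lhs => rw [← this, Finset.sum_map]
    rfl
  · have hjS : j ∉ A.erase i := fun hmem => hj (Finset.mem_of_mem_erase hmem)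
    rw [← Finset.insert_erase hi, insert_mem_iff_of_lt h hij.le hw (Finset.notMem_erase _ _) hjS,
      h, key i j _ hij.ne (Finset.notMem_erase _ _) hjS]
  · have hiS : i ∉ A.erase j := fun hmem => hi (Finset.mem_of_mem_erase hmem)
    rw [← Finset.insert_erase hj,
      ← insert_mem_iff_of_lt h hij.le hw hiS (Finset.notMem_erase _ _), h, Equiv.swap_comm,
      key j i _ hij.ne' (Finset.notMem_erase _ _) hiS]
  · rw [h]
    refine iff_of_eq (congrArg _ (Finset.sum_congr rfl fun k hk => ?_))
    rw [Equiv.swap_apply_of_ne_of_ne (ne_of_mem_of_not_mem hk hi) (ne_of_mem_of_not_mem hk hj)]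

/-- A weighted game of `J_n` is realized by weights in increasing order. -/
theorem LinearGame.exists_monotone_weights {n : ℕ} {v : LinearGame n} (hv : v.IsWeighted) :
    ∃ (q : ℝ) (w : Fin n → ℝ), Monotone w ∧ (∀ i, 0 ≤ w i) ∧
      ∀ A, A ∈ v.winning ↔ q ≤ ∑ i ∈ A, w i := by
  obtain ⟨q, w, hpos, -, -, h⟩ := hv
  -- Rearrangement argument: among the permutations of the weights that realize `v`, maximize the
  -- sum of label times weight. Swapping an inversion would still realize `v` and increase this sum.
  obtain ⟨σ, hσ, hmax⟩ := (Set.toFinite {σ : Equiv.Perm (Fin n) |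
    ∀ A, A ∈ v.winning ↔ q ≤ ∑ i ∈ A, w (σ i)}).exists_maximalFor
    (fun σ => ∑ i : Fin n, ((i : ℕ) : ℝ) * w (σ i)) _ ⟨1, by simpa using h⟩
  refine ⟨q, fun i => w (σ i), fun i j hij => ?_, fun i => hpos _, hσ⟩
  by_contra! hlt
  have hij' : i < j := lt_of_le_of_ne hij fun e => by simp [e] at hlt
  have hmem : σ * Equiv.swap i j ∈ {σ : Equiv.Perm (Fin n) |
      ∀ A, A ∈ v.winning ↔ q ≤ ∑ i ∈ A, w (σ i)} :=
    realizes_comp_swap (w := fun i => w (σ i)) hσ hij' hlt.le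
  have hdiff : ∑ k : Fin n, ((k : ℕ) : ℝ) * w ((σ * Equiv.swap i j) k) -
      ∑ k : Fin n, ((k : ℕ) : ℝ) * w (σ k) = ((j : ℕ) - (i : ℕ) : ℝ) * (w (σ i) - w (σ j)) := by
    rw [← Finset.sum_sub_distrib, Fintype.sum_eq_add i j hij'.ne]
    · simp only [Equiv.Perm.mul_apply, Equiv.swap_apply_left, Equiv.swap_apply_right]
      ring
    · rintro k ⟨hki, hkj⟩
      rw [Equiv.Perm.mul_apply, Equiv.swap_apply_of_ne_of_ne hki hkj, sub_self]
  have hpos' : 0 < ((j : ℕ) - (i : ℕ) : ℝ) * (w (σ i) - w (σ j)) :=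
    mul_pos (sub_pos.2 (by exact_mod_cast hij')) (sub_pos.2 hlt)
  have hle := hmax hmem (by dsimp only; linarith)
  dsimp only at hle
  linarith

/-- Losing coalitions lie strictly below the quota and are finite in number, so the quota can be
lowered slightly to make winning strict as well. Dividing by the total weight normalizes. -/
theorem LinearGame.exists_separates {n : ℕ} {v : LinearGame n} (hv : v.IsWeighted) :
    ∃ p : ℝ × (Fin n → ℝ), p.2 ∈ normalizedWeights n ∧ v.Separates ∅ p := by
  obtain ⟨q, w, hmono, hpos, h⟩ := exists_monotone_weights hv
  have hq : 0 < q := by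
    by_contra! hq
    exact v.empty_losing ((h ∅).2 (by simpa using hq))
  have hs : 0 < ∑ i, w i := hq.trans_le ((h _).1 v.univ_winning)
  have hev : ∀ᶠ t : ℝ in 𝓝[>] 0, ∀ A, A ∉ v.winning → ∑ i ∈ A, w i < q - t := by
    refine eventually_all.2 fun A => ?_
    by_cases hA : A ∈ v.winning
    · simp [hA]
    · have hlt : 0 < q - ∑ i ∈ A, w i := by
        rw [h] at hA
        linarith
      filter_upwards [Ioo_mem_nhdsGT hlt] with t ht _
      linarith [ht.2]
  obtain ⟨t, ht, ht0⟩ := (hev.and self_mem_nhdsWithin).exists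
  have ht0 : 0 < t := ht0
  set s := ∑ i, w i
  refine ⟨((q - t) / s, fun i => w i / s), ⟨fun i j hij => ?_, fun i => ?_, ?_⟩, fun A _ => ?_⟩
  · have := hmono hij
    dsimp only
    gcongr
  · exact div_nonneg (hpos i) hs.le
  · rw [← Finset.sum_div]
    exact div_self hs.ne'
  · rw [coalitionForm_apply, ← Finset.sum_div, ← sub_div]
    refine ⟨fun hA => div_neg_of_neg_of_pos ?_ hs, fun hA => div_pos ?_ hs⟩
    · have := (h A).1 hA
      linarith
    · have := ht A hA
      linarith

/-! ### Walls and weighted neighbours -/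

/-- The game realized by a point with normalized weights. -/
def LinearGame.ofPoint {n : ℕ} (p : ℝ × (Fin n → ℝ)) (hw : p.2 ∈ normalizedWeights n)
    (h₀ : 0 < p.1) (h₁ : p.1 ≤ 1) : LinearGame n where
  winning := {A | p.1 ≤ ∑ i ∈ A, p.2 i}
  univ_winning := h₁.trans hw.2.2.ge
  empty_losing h := by
    have h : p.1 ≤ ∑ i ∈ ∅, p.2 i := h
    rw [Finset.sum_empty] at h
    exact h.not_gt h₀
  mono S R hS hSR := le_trans (show p.1 ≤ _ from hS) (sum_mono_of_monotone hw.2.1 hSR)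
  desirable i j hij S hj hi hS := by
    have hS : p.1 ≤ ∑ k ∈ insert i S, p.2 k := hS
    show p.1 ≤ ∑ k ∈ insert j S, p.2 k
    rw [Finset.sum_insert hi] at hS
    rw [Finset.sum_insert hj]
    linarith [hw.1 hij]

theorem LinearGame.mem_ofPoint {n : ℕ} {p : ℝ × (Fin n → ℝ)} {hw : p.2 ∈ normalizedWeights n}
    {h₀ : 0 < p.1} {h₁ : p.1 ≤ 1} {A : Finset (Fin n)} :
    A ∈ (ofPoint p hw h₀ h₁).winning ↔ coalitionForm A p ≤ 0 := by
  rw [coalitionForm_apply, sub_nonpos]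
  rfl

theorem LinearGame.isWeighted_ofPoint {n : ℕ} {p : ℝ × (Fin n → ℝ)}
    {hw : p.2 ∈ normalizedWeights n} {h₀ : 0 < p.1} {h₁ : p.1 ≤ 1} :
    (ofPoint p hw h₀ h₁).IsWeighted :=
  ⟨p.1, p.2, hw.2.1, h₀, h₁.trans hw.2.2.ge, fun _ => Iff.rfl⟩

/-- Raising the quota slightly at the wall point makes `A` lose and changes nothing else. -/
theorem LinearGame.exists_winning_eq_diff_of_hasWall {n : ℕ} {v : LinearGame n}
    {A : Finset (Fin n)} (hA : A ∈ v.winning) (hne : A ≠ Finset.univ) (h : v.HasWall A) :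
    ∃ u : LinearGame n, u.IsWeighted ∧ u.winning = v.winning \ {A} := by
  obtain ⟨p, hw, hpA, hp⟩ := h
  obtain ⟨t, ht, ht0⟩ := ((eventually_add_smul_mem (v.isOpen_separates {A}) hp (1, 0)).and
    self_mem_nhdsWithin).exists
  have ht : v.Separates {A} (p + t • (1, 0)) := ht
  have ht0 : 0 < t := ht0
  set r : ℝ × (Fin n → ℝ) := p + t • (1, 0) with hr
  have hrw : r.2 ∈ normalizedWeights n := by simpa [hr] using hw
  have h₀ : 0 < r.1 := by
    have := (ht ∅ fun e => v.empty_losing ((Set.mem_singleton_iff.1 e) ▸ hA)).2 v.empty_losing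
    simpa using this
  have h₁ : r.1 ≤ 1 := by
    have := (ht Finset.univ fun e => hne (Set.mem_singleton_iff.1 e).symm).1 v.univ_winning
    rw [coalitionForm_apply, hrw.2.2] at this
    linarith
  refine ⟨ofPoint r hrw h₀ h₁, isWeighted_ofPoint, Set.ext fun B => ?_⟩
  rw [mem_ofPoint]
  by_cases hBA : B = A
  · subst hBA
    have : coalitionForm B r = t := by
      rw [hr, map_add, hpA]
      simp
    simp [-coalitionForm_apply, this, ht0]
  · have := ht B hBA
    by_cases hB : B ∈ v.winning
    · simp only [Set.mem_sdiff, hB, Set.mem_singleton_iff, hBA, not_false_eq_true, and_self, iff_true]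
      exact (this.1 hB).le
    · simp only [Set.mem_sdiff, hB, false_and, iff_false, not_le]
      exact this.2 hB

/-- No move is needed: a tie with the quota wins, so the wall point itself realizes the game with
`A` added. -/
theorem LinearGame.exists_winning_eq_insert_of_hasWall {n : ℕ} {v : LinearGame n}
    {A : Finset (Fin n)} (hA : A ∉ v.winning) (hne : A ≠ ∅) (h : v.HasWall A) :
    ∃ u : LinearGame n, u.IsWeighted ∧ u.winning = insert A v.winning := by
  obtain ⟨p, hw, hpA, hp⟩ := h
  have h₀ : 0 < p.1 := by
    simpa using (hp ∅ fun e => hne (Set.mem_singleton_iff.1 e).symm).2 v.empty_losing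
  have h₁ : p.1 ≤ 1 := by
    have := (hp Finset.univ fun e => hA ((Set.mem_singleton_iff.1 e) ▸ v.univ_winning)).1
      v.univ_winning
    rw [coalitionForm_apply, hw.2.2] at this
    linarith
  refine ⟨ofPoint p hw h₀ h₁, isWeighted_ofPoint, Set.ext fun B => ?_⟩
  rw [mem_ofPoint, Set.mem_insert_iff]
  by_cases hBA : B = A
  · simp [-coalitionForm_apply, hBA, hpA]
  · have := hp B hBA
    by_cases hB : B ∈ v.winning
    · simp only [hB, or_true, iff_true]
      exact (this.1 hB).le
    · simp only [hB, hBA, or_self, iff_false, not_le]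
      exact this.2 hB

/-- Strict realizations of `v` and `u` lie on opposite sides of `h_A` and on the same side of every
other `h_B`. The coefficients `α` and `β` locate where their segment crosses `h_A`. -/
theorem LinearGame.hasWall_of_isWeighted {n : ℕ} {u v : LinearGame n} {A : Finset (Fin n)}
    (hv : v.IsWeighted) (hu : u.IsWeighted) (h : ∀ B, B ≠ A → (B ∈ u.winning ↔ B ∈ v.winning))
    (hA : A ∈ u.winning ↔ A ∉ v.winning) : v.HasWall A := by
  obtain ⟨p, hpw, hp⟩ := exists_separates hv
  obtain ⟨r, hrw, hr⟩ := exists_separates hu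
  set a := coalitionForm A p with ha
  set b := coalitionForm A r with hb
  obtain ⟨hα, hβ, hne⟩ : 0 < b / (b - a) ∧ 0 < a / (a - b) ∧ a ≠ b := by
    by_cases hAv : A ∈ v.winning
    · have h₁ := (hp A (by simp)).1 hAv
      have h₂ := (hr A (by simp)).2 fun e => hA.1 e hAv
      exact ⟨div_pos h₂ (by linarith), div_pos_of_neg_of_neg h₁ (by linarith), by linarith⟩
    · have h₁ := (hp A (by simp)).2 hAv
      have h₂ := (hr A (by simp)).1 (hA.2 hAv)
      exact ⟨div_pos_of_neg_of_neg h₂ (by linarith), div_pos h₁ (by linarith), by linarith⟩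
  set α := b / (b - a) with hα'
  set β := a / (a - b) with hβ'
  have h₁ : b - a ≠ 0 := sub_ne_zero.2 hne.symm
  have h₂ : a - b ≠ 0 := sub_ne_zero.2 hne
  have hβα : β = -a / (b - a) := by
    rw [hβ', ← neg_sub b a, div_neg, neg_div]
  have hsum : α + β = 1 := by
    rw [hβα, hα', ← add_div, ← sub_eq_add_neg, div_self h₁]
  have hzero : α * a + β * b = 0 := by
    rw [hβα, hα']
    ring
  refine ⟨α • p + β • r, ⟨fun i j hij => ?_, fun i => ?_, ?_⟩, ?_, fun B hB => ?_⟩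
  · have h₃ := mul_le_mul_of_nonneg_left (hpw.1 hij) hα.le
    have h₄ := mul_le_mul_of_nonneg_left (hrw.1 hij) hβ.le
    simpa using add_le_add h₃ h₄
  · have h₃ := mul_nonneg hα.le (hpw.2.1 i)
    have h₄ := mul_nonneg hβ.le (hrw.2.1 i)
    simpa using add_nonneg h₃ h₄
  · have h₃ := hpw.2.2
    have h₄ := hrw.2.2
    rw [← totalForm_apply] at h₃ h₄ ⊢
    simp [-totalForm_apply, h₃, h₄, hsum]
  · rw [map_add, map_smul, map_smul]
    exact hzero
  · have h₃ := hp B (by simp)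
    have h₄ := hr B (by simp)
    rw [h B hB] at h₄
    rw [map_add, map_smul, map_smul, smul_eq_mul, smul_eq_mul]
    refine ⟨fun hBv => ?_, fun hBv => ?_⟩
    · exact add_neg (mul_neg_of_pos_of_neg hα (h₃.1 hBv)) (mul_neg_of_pos_of_neg hβ (h₄.1 hBv))
    · exact add_pos (mul_pos hα (h₃.2 hBv)) (mul_pos hβ (h₄.2 hBv))

/-- A winning coalition below `A` weighs at most the quota, while any winning one other than `A`
weighs strictly more at the wall point. -/
theorem LinearGame.shiftMinimal_of_hasWall {n : ℕ} {v : LinearGame n} {A : Finset (Fin n)}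
    (hA : A ∈ v.winning) (h : v.HasWall A) : A ∈ v.shiftMinimalWinning := by
  obtain ⟨p, hw, hpA, hp⟩ := h
  refine ⟨hA, fun B hB hBA => ?_⟩
  by_contra hne
  have h₁ := (hp B hne).1 hB
  have h₂ := sum_le_sum_of_coalitionLE hw.1 hw.2.1 hBA
  rw [coalitionForm_apply] at hpA h₁
  linarith

theorem LinearGame.eq_univ_of_shiftMinimal {n : ℕ} {v : LinearGame n}
    (h : Finset.univ ∈ v.shiftMinimalWinning) {A : Finset (Fin n)} (hA : A ∈ v.winning) :
    A = Finset.univ :=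
  h.2 A hA (coalitionLE_of_subset (Finset.subset_univ A))

/-- Only the grand coalition wins here, so the quota of a strict realization can be raised to the
total weight. -/
theorem LinearGame.hasWall_univ {n : ℕ} {v : LinearGame n} (hv : v.IsWeighted)
    (h : Finset.univ ∈ v.shiftMinimalWinning) : v.HasWall Finset.univ := by
  obtain ⟨p, hw, hp⟩ := exists_separates hv
  have h₁ := (hp Finset.univ (by simp)).1 v.univ_winning
  rw [coalitionForm_apply, hw.2.2] at h₁
  refine ⟨(1, p.2), hw, by simp [hw.2.2], fun B hB => ⟨fun hBv => ?_, fun hBv => ?_⟩⟩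
  · exact absurd (eq_univ_of_shiftMinimal h hBv) hB
  · have h₂ := (hp B (by simp)).2 hBv
    rw [coalitionForm_apply] at h₂ ⊢
    dsimp only
    linarith

/-! ### Counting neighbours and conclusion -/

theorem Set.encard_eq_of_rel {α β : Type*} {U : Set α} {T : Set β} (r : α → β → Prop)
    (h₁ : ∀ u ∈ U, ∃ a ∈ T, r u a) (h₂ : ∀ a ∈ T, ∃ u ∈ U, r u a)
    (hl : ∀ u u' a, r u a → r u' a → u = u') (hr : ∀ u a a', r u a → r u a' → a = a') :
    U.encard = T.encard := by
  choose f hfT hf using h₁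
  choose g hgU hg using h₂
  refine le_antisymm (Function.Embedding.encard_le ⟨fun u => ⟨f u u.2, hfT u u.2⟩, ?_⟩)
    (Function.Embedding.encard_le ⟨fun a => ⟨g a a.2, hgU a a.2⟩, ?_⟩)
  · intro u u' e
    refine Subtype.ext (hl u u' (f u u.2) (hf u u.2) ?_)
    rw [show f u u.2 = f u' u'.2 from congrArg Subtype.val e]
    exact hf u' u'.2
  · intro a a' e
    refine Subtype.ext (hr (g a a.2) a a' (hg a a.2) ?_)
    rw [show g a a.2 = g a' a'.2 from congrArg Subtype.val e]
    exact hg a' a'.2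

/-- `u` arises from `v` by making the winning coalition `A` losing. -/
def LinearGame.Loses {n : ℕ} (v u : LinearGame n) (A : Finset (Fin n)) : Prop :=
  A ∈ v.winning ∧ u.winning = v.winning \ {A}

section Loses

variable {n : ℕ} {u v : LinearGame n} {A B : Finset (Fin n)}

theorem LinearGame.Loses.winning_eq_insert (h : v.Loses u A) : v.winning = insert A u.winning := by
  rw [h.2, Set.insert_sdiff_singleton, Set.insert_eq_of_mem h.1]

theorem LinearGame.Loses.notMem (h : v.Loses u A) : A ∉ u.winning := by
  rw [h.2]
  simp

theorem LinearGame.loses_of_winning_eq_insert (hA : A ∉ u.winning)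
    (h : v.winning = insert A u.winning) : v.Loses u A := by
  refine ⟨h ▸ Set.mem_insert _ _, ?_⟩
  rw [h, Set.insert_sdiff_of_mem _ (Set.mem_singleton _), Set.sdiff_singleton_eq_self hA]

theorem LinearGame.Loses.coalition_unique (hA : v.Loses u A) (hB : v.Loses u B) : A = B := by
  have h := hA.winning_eq_insert.symm.trans hB.winning_eq_insert
  have hmem : A ∈ insert B u.winning := h ▸ Set.mem_insert _ _
  exact hmem.resolve_right hA.notMem

theorem LinearGame.Loses.mem_iff (h : v.Loses u A) (hB : B ≠ A) :
    B ∈ u.winning ↔ B ∈ v.winning := by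
  rw [h.2]
  simp [hB]

theorem LinearGame.Loses.covBy (h : v.Loses u A) : v ⋖ u := covBy_of_winning_eq_diff h.1 h.2

end Loses

theorem LinearGame.encard_covering {n : ℕ} (v : LinearGame n) :
    {u : LinearGame n | v ⋖ u}.encard =
      {A | A ∈ v.shiftMinimalWinning ∧ A ≠ Finset.univ}.encard := by
  refine Set.encard_eq_of_rel v.Loses (fun u hu => ?_) (fun A hA => ?_) (fun u u' A h h' => ?_)
    fun u A B h h' => h.coalition_unique h'
  · obtain ⟨A, hA, hne, h⟩ := exists_shiftMinimal_of_covBy hu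
    exact ⟨A, ⟨hA, hne⟩, hA.1, h⟩
  · exact ⟨v.remove A hA.1 hA.2, covBy_of_winning_eq_diff hA.1.1 rfl, hA.1.1, rfl⟩
  · exact ext_winning (h.2.trans h'.2.symm)

theorem LinearGame.encard_weighted_covering {n : ℕ} {v : LinearGame n} (hv : v.IsWeighted) :
    {u : LinearGame n | v ⋖ u ∧ u.IsWeighted}.encard =
      {A | A ∈ v.winning ∧ A ≠ Finset.univ ∧ v.HasWall A}.encard := by
  refine Set.encard_eq_of_rel v.Loses (fun u hu => ?_) (fun A hA => ?_) (fun u u' A h h' => ?_)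
    fun u A B h h' => h.coalition_unique h'
  · obtain ⟨A, hA, hne, h⟩ := exists_shiftMinimal_of_covBy hu.1
    have hL : v.Loses u A := ⟨hA.1, h⟩
    exact ⟨A, ⟨hA.1, hne, hasWall_of_isWeighted hv hu.2 (fun B hB => hL.mem_iff hB)
      (by simp [hL.notMem, hL.1])⟩, hL⟩
  · obtain ⟨u, hu, h⟩ := exists_winning_eq_diff_of_hasWall hA.1 hA.2.1 hA.2.2
    exact ⟨u, ⟨covBy_of_winning_eq_diff hA.1 h, hu⟩, hA.1, h⟩
  · exact ext_winning (h.2.trans h'.2.symm)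

theorem LinearGame.encard_weighted_covered {n : ℕ} {v : LinearGame n} (hv : v.IsWeighted) :
    {u : LinearGame n | u ⋖ v ∧ u.IsWeighted}.encard =
      {A | A ∉ v.winning ∧ A ≠ ∅ ∧ v.HasWall A}.encard := by
  refine Set.encard_eq_of_rel (fun u A => u.Loses v A) (fun u hu => ?_) (fun A hA => ?_)
    (fun u u' A h h' => ?_) fun u A B h h' => h.coalition_unique h'
  · obtain ⟨A, hA, hne, h⟩ := exists_shiftMinimal_of_covBy hu.1
    have hL : u.Loses v A := ⟨hA.1, h⟩
    exact ⟨A, ⟨hL.notMem, fun e => u.empty_losing (e ▸ hA.1), hasWall_of_isWeighted hv hu.2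
      (fun B hB => (hL.mem_iff hB).symm) (by simp [hL.notMem, hL.1])⟩, hL⟩
  · obtain ⟨u, hu, h⟩ := exists_winning_eq_insert_of_hasWall hA.1 hA.2.1 hA.2.2
    have hL : u.Loses v A := loses_of_winning_eq_insert hA.1 h
    exact ⟨u, ⟨hL.covBy, hu⟩, hL⟩
  · exact ext_winning (h.winning_eq_insert.trans h'.winning_eq_insert.symm)

/-- If `h_∅` carries a wall of `v`, every nonempty coalition wins. -/
theorem LinearGame.not_covBy_of_hasWall_empty {n : ℕ} {u v : LinearGame n} (h : v.HasWall ∅) :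
    ¬ u ⋖ v := by
  intro huv
  obtain ⟨A, hA, -, hdiff⟩ := exists_shiftMinimal_of_covBy huv
  have hL : u.Loses v A := ⟨hA.1, hdiff⟩
  obtain ⟨p, hw, hp0, hp⟩ := h
  have hne : A ≠ ∅ := fun e => u.empty_losing (e ▸ hA.1)
  have h₁ := (hp A hne).2 hL.notMem
  have h₂ : 0 ≤ ∑ i ∈ A, p.2 i := Finset.sum_nonneg fun i _ => hw.2.1 i
  simp only [coalitionForm_apply, Finset.sum_empty, sub_zero] at hp0 h₁
  linarith

theorem LinearGame.encard_and_not_eq {n : ℕ} {U : LinearGame n → Prop} {T : Set (Finset (Fin n))}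
    (h : {u | U u ∧ u.IsWeighted}.encard = T.encard) {k : ℕ}
    (hk : {u | U u}.encard = T.encard + (k : ℕ∞)) :
    {u | U u ∧ ¬ u.IsWeighted}.encard = (k : ℕ∞) := by
  have hsplit : {u | U u}.encard =
      {u | U u ∧ u.IsWeighted}.encard + {u | U u ∧ ¬ u.IsWeighted}.encard := by
    rw [← Set.encard_union_eq]
    · congr 1
      ext u
      simp only [Set.mem_ofPred_eq, Set.mem_union]
      tauto
    · exact Set.disjoint_left.2 fun u h₁ h₂ => h₂.2 h₁.2
  -- Cancellation in `ℕ∞` is legitimate because `T` is finite.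
  rw [h, hk] at hsplit
  exact (WithTop.add_left_cancel (Set.encard_ne_top_iff.2 T.toFinite) hsplit).symm

theorem corollary4p11 {n : ℕ} (v : LinearGame n) (hv : v.IsWeighted) :
    (∀ k : ℕ, v.shiftMinimalWinning.encard = v.topFacets.encard + (k : ℕ∞) →
      {u : LinearGame n | v ⋖ u ∧ ¬ u.IsWeighted}.encard = (k : ℕ∞)) ∧
    (∀ l : ℕ, {u : LinearGame n | u ⋖ v}.encard = v.bottomFacets.encard + (l : ℕ∞) →
      {u : LinearGame n | u ⋖ v ∧ ¬ u.IsWeighted}.encard = (l : ℕ∞)) := by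
  obtain ⟨p, hw, hp⟩ := LinearGame.exists_separates hv
  have htop : v.topFacets.encard = {A | A ∈ v.winning ∧ v.HasWall A}.encard :=
    LinearGame.encard_facets hw hp v.winning
  have hbot : v.bottomFacets.encard = {A | A ∉ v.winning ∧ v.HasWall A}.encard :=
    LinearGame.encard_facets hw hp v.winningᶜ
  refine ⟨fun k hk => ?_, fun l hl => ?_⟩
  -- If the grand coalition is shift-minimal, it is the only winning one: there is one shift-minimal
  -- coalition, one top facet and no cover, so `k = 0`. Otherwise excluding it from either count
  -- changes nothing.
  · by_cases huniv : Finset.univ ∈ v.shiftMinimalWinning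
    · have hS : v.shiftMinimalWinning = {Finset.univ} :=
        Set.Subset.antisymm (fun A hA => LinearGame.eq_univ_of_shiftMinimal huniv hA.1)
          (Set.singleton_subset_iff.2 huniv)
      have hT : {A | A ∈ v.winning ∧ v.HasWall A} = {Finset.univ} :=
        Set.Subset.antisymm (fun A hA => LinearGame.eq_univ_of_shiftMinimal huniv hA.1)
          (Set.singleton_subset_iff.2 ⟨v.univ_winning, LinearGame.hasWall_univ hv huniv⟩)
      have hcov := v.encard_covering
      have hempty : {A | A ∈ v.shiftMinimalWinning ∧ A ≠ Finset.univ} = ∅ := by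
        rw [hS]
        exact Set.eq_empty_of_forall_notMem fun A hA => hA.2 hA.1
      rw [hempty, Set.encard_empty, Set.encard_eq_zero] at hcov
      rw [htop, hS, hT, Set.encard_singleton] at hk
      have hk0 : k = 0 := by
        norm_cast at hk
        omega
      rw [hk0, Nat.cast_zero, Set.encard_eq_zero]
      exact Set.eq_empty_of_forall_notMem fun u hu =>
        Set.notMem_empty u (hcov ▸ (show u ∈ {u : LinearGame n | v ⋖ u} from hu.1))
    · refine LinearGame.encard_and_not_eq (LinearGame.encard_weighted_covering hv) ?_
      have h₁ : {A | A ∈ v.shiftMinimalWinning ∧ A ≠ Finset.univ} = v.shiftMinimalWinning :=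
        Set.ext fun A => and_iff_left_of_imp fun hA e => huniv (e ▸ hA)
      have h₂ : {A | A ∈ v.winning ∧ A ≠ Finset.univ ∧ v.HasWall A} =
          {A | A ∈ v.winning ∧ v.HasWall A} :=
        Set.ext fun A => and_congr_right fun hA => and_iff_right_of_imp fun hwall e =>
          huniv (e ▸ LinearGame.shiftMinimal_of_hasWall hA hwall)
      rw [v.encard_covering, h₁, h₂, hk, htop]
  -- If `v` covers some game, `h_∅` carries no wall, so excluding `∅` is harmless. If it covers
  -- none, the hypothesis forces `l = 0`.
  · by_cases hcov : ∃ u : LinearGame n, u ⋖ v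
    · obtain ⟨u, hu⟩ := hcov
      refine LinearGame.encard_and_not_eq (LinearGame.encard_weighted_covered hv) ?_
      have h₂ : {A | A ∉ v.winning ∧ A ≠ ∅ ∧ v.HasWall A} =
          {A | A ∉ v.winning ∧ v.HasWall A} :=
        Set.ext fun A => and_congr_right fun _ => and_iff_right_of_imp fun hwall e =>
          LinearGame.not_covBy_of_hasWall_empty (e ▸ hwall) hu
      rw [hl, hbot, h₂]
    · have h₁ : {u : LinearGame n | u ⋖ v} = ∅ :=
        Set.eq_empty_of_forall_notMem fun u hu => hcov ⟨u, hu⟩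
      rw [h₁, Set.encard_empty] at hl
      rw [(add_eq_zero.1 hl.symm).2, Set.encard_eq_zero]
      exact Set.eq_empty_of_forall_notMem fun u hu => hcov ⟨u, hu.1⟩
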